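/- For $n\ge 0$ let $[n]!=\prod_{i=1}^{n}\frac{1-q^i}{1-q}$, and for tuples of positive integers $a=(a_1,\dots,a_r)$, $b=(b_1,\dots,b_s)$ let $$D(a,b;q)=\frac{[a_1]!\cdots[a_r]!}{[b_1]!\cdots[b_s]!}.$$ Call a polynomial $\sum_{i=0}^k c_iq^i$ of degree $k$ with integer coefficients unimodal (here always including symmetric) if $c_i=c_{k-i}$ for all $0\le i\le k$ and $c_0\le c_1\le\dots\le c_{\lfloor k/2\rfloor}$. Then $D(a,b;q)$ is a polynomial with integer coefficients and $(1+q)D(a,b;q)$ is unimodal in each of the following cases: (i) $(a,b)$ is one of the 52 sporadic irreducible coprime pairs of height one in Bober's list, namely $((1,12),(3,4,6)),$ $((2,3,12),(1,4,6,6)),$ $((1,9),(2,3,5)),$ $((2,9),(1,4,6)),$ $((4,9),(2,3,8)),$ $((1,12),(2,3,8)),$ $((3,12),(1,6,8)),$ $((3,12),(4,5,6)),$ $((5,12),(3,4,10)),$ $((1,18),(4,6,9)),$ $((3,4,18),(2,6,8,9)),$ $((3,5,18),(1,6,9,10)),$ $((6,10),(2,5,9)),$ $((2,12),(1,4,9)),$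 $((2,12),(3,4,7)),$ $((1,14),(3,5,7)),$ $((3,14),(1,7,9)),$ $((2,18),(5,6,9)),$ $((4,18),(1,9,12)),$ $((1,6,10),(2,3,5,7)),$ $((4,6,14),(2,3,7,12)),$ $((2,3,18),(1,6,7,9)),$ $((1,15),(2,5,9)),$ $((1,15),(3,5,8)),$ $((2,15),(1,6,10)),$ $((2,15),(3,4,10)),$ $((4,15),(2,5,12)),$ $((4,15),(5,6,8)),$ $((7,15),(3,5,14)),$ $((1,20),(3,8,10)),$ $((1,20),(4,7,10)),$ $((3,20),(1,10,12)),$ $((3,20),(4,9,10)),$ $((1,24),(5,8,12)),$ $((1,30),(6,10,15)),$ $((1,6,15),(2,3,5,12)),$ $((2,3,20),(1,6,8,10)),$ $((1,6,20),(2,3,10,12)),$ $((2,7,20),(1,4,10,14)),$ $((6,9,20),(3,4,10,18)),$ $((1,4,24),(2,7,8,12)),$ $((3,4,24),(2,8,9,12)),$ $((2,5,24),(1,8,10,12)),$ $((4,7,24),(1,8,12,14)),$ $((2,3,30),(4,6,10,15)),$ $((3,5,30),(1,10,12,15)),$ $((3,5,30),(6,7,10,15)),$ $((4,5,30),(2,10,12,15)),$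 $((4,5,30),(6,8,10,15)),$ $((5,9,30),(1,10,15,18)),$ $((4,6,9,24),(2,3,8,12,18)),$ $((2,3,5,30),(1,6,8,10,15))$; (ii) $(a,b)=((m+n),(m,n))$ with $m,n$ relatively prime positive integers. -/

import Mathlib

open Polynomial

noncomputable section

/-- The `q`-number `[n] = (1 - q ^ n) / (1 - q) = 1 + q + ⋯ + q ^ (n - 1)`,
a polynomial in `q = X`. -/
def qNumber (n : ℕ) : ℤ[X] := ∑ i ∈ Finset.range n, X ^ i

theorem one_sub_X_mul_qNumber (n : ℕ) : (1 - X) * qNumber n = 1 - X ^ n :=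
  mul_neg_geom_sum X n

/-- The `q`-factorial `[n]! = [1][2]⋯[n]`. -/
def qFactorial (n : ℕ) : ℤ[X] := ∏ i ∈ Finset.range n, qNumber (i + 1)

/-- The `q`-factorial ratio `D(a, b; q) = ([a₁]!⋯[aᵣ]!) / ([b₁]!⋯[bₛ]!)`, a rational function. -/
def qFactorialRatio (a b : List ℕ) : RatFunc ℤ :=
  algebraMap ℤ[X] (RatFunc ℤ) (a.map qFactorial).prod /
    algebraMap ℤ[X] (RatFunc ℤ) (b.map qFactorial).prod

/-- With `k` the degree of `P = ∑ cᵢ qⁱ`: the sequence `(c₀, …, cₖ)` satisfies `cᵢ = cₖ₋ᵢ`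
and `c₀ ≤ c₁ ≤ ⋯ ≤ c_⌊k/2⌋`. -/
def IsSymmUnimodal (P : ℤ[X]) : Prop :=
  (∀ i ≤ P.natDegree, P.coeff i = P.coeff (P.natDegree - i)) ∧
    ∀ i, i + 1 ≤ P.natDegree / 2 → P.coeff i ≤ P.coeff (i + 1)

/-- The ratio `D(a, b; q)` is a polynomial `P` with integer coefficients, and `(1 + q) P` is
(symmetric and) unimodal. -/
def IsQRiousUnimodal (a b : List ℕ) : Prop :=
  ∃ P : ℤ[X], algebraMap ℤ[X] (RatFunc ℤ) P = qFactorialRatio a b ∧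
    IsSymmUnimodal ((1 + X) * P)

/-- Bober's 52 sporadic irreducible coprime pairs `(a, b)` of height one. -/
def boberSporadicPairs : List (List ℕ × List ℕ) :=
  [([1, 12], [3, 4, 6]),
   ([2, 3, 12], [1, 4, 6, 6]),
   ([1, 9], [2, 3, 5]),
   ([2, 9], [1, 4, 6]),
   ([4, 9], [2, 3, 8]),
   ([1, 12], [2, 3, 8]),
   ([3, 12], [1, 6, 8]),
   ([3, 12], [4, 5, 6]),
   ([5, 12], [3, 4, 10]),
   ([1, 18], [4, 6, 9]),
   ([3, 4, 18], [2, 6, 8, 9]),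
   ([3, 5, 18], [1, 6, 9, 10]),
   ([6, 10], [2, 5, 9]),
   ([2, 12], [1, 4, 9]),
   ([2, 12], [3, 4, 7]),
   ([1, 14], [3, 5, 7]),
   ([3, 14], [1, 7, 9]),
   ([2, 18], [5, 6, 9]),
   ([4, 18], [1, 9, 12]),
   ([1, 6, 10], [2, 3, 5, 7]),
   ([4, 6, 14], [2, 3, 7, 12]),
   ([2, 3, 18], [1, 6, 7, 9]),
   ([1, 15], [2, 5, 9]),
   ([1, 15], [3, 5, 8]),
   ([2, 15], [1, 6, 10]),
   ([2, 15], [3, 4, 10]),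
   ([4, 15], [2, 5, 12]),
   ([4, 15], [5, 6, 8]),
   ([7, 15], [3, 5, 14]),
   ([1, 20], [3, 8, 10]),
   ([1, 20], [4, 7, 10]),
   ([3, 20], [1, 10, 12]),
   ([3, 20], [4, 9, 10]),
   ([1, 24], [5, 8, 12]),
   ([1, 30], [6, 10, 15]),
   ([1, 6, 15], [2, 3, 5, 12]),
   ([2, 3, 20], [1, 6, 8, 10]),
   ([1, 6, 20], [2, 3, 10, 12]),
   ([2, 7, 20], [1, 4, 10, 14]),
   ([6, 9, 20], [3, 4, 10, 18]),
   ([1, 4, 24], [2, 7, 8, 12]),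
   ([3, 4, 24], [2, 8, 9, 12]),
   ([2, 5, 24], [1, 8, 10, 12]),
   ([4, 7, 24], [1, 8, 12, 14]),
   ([2, 3, 30], [4, 6, 10, 15]),
   ([3, 5, 30], [1, 10, 12, 15]),
   ([3, 5, 30], [6, 7, 10, 15]),
   ([4, 5, 30], [2, 10, 12, 15]),
   ([4, 5, 30], [6, 8, 10, 15]),
   ([5, 9, 30], [1, 10, 15, 18]),
   ([4, 6, 9, 24], [2, 3, 8, 12, 18]),
   ([2, 3, 5, 30], [1, 6, 8, 10, 15])]

/-- Landau's criterion. -/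
def Landau (a b : List ℕ) : Prop :=
  ∀ x : ℝ, 0 ≤ x → 0 ≤ (a.map fun n : ℕ => ⌊(n : ℝ) * x⌋).sum - (b.map fun n : ℕ => ⌊(n : ℝ) * x⌋).sum

/-- The list consists of 52 distinct pairs of tuples of positive integers, each of height one,
balanced and coprime. -/
theorem boberSporadicPairs_spec :
    boberSporadicPairs.length = 52 ∧ boberSporadicPairs.Nodup ∧
      ∀ p ∈ boberSporadicPairs, (∀ n ∈ p.1 ++ p.2, 0 < n) ∧ p.2.length = p.1.length + 1 ∧
        p.1.sum = p.2.sum ∧ (p.1 ++ p.2).foldr Nat.gcd 0 = 1 := by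
  refine ⟨?_, ?_, ?_⟩ <;> decide +kernel

theorem sum_map_floor {N : ℕ} (hN : 0 < N) {x : ℝ} (hx : 0 ≤ x) (l : List ℕ)
    (hl : ∀ n ∈ l, 0 < n ∧ n ∣ N) :
    (l.map fun n : ℕ => ⌊(n : ℝ) * x⌋).sum =
      (((l.sum * (⌊N * x⌋₊ / N) + (l.map fun n => n * (⌊N * x⌋₊ % N) / N).sum : ℕ)) : ℤ) := by
  induction l with
  | nil => simp
  | cons n l ih =>
    have ih := ih fun k hk => hl k (List.mem_cons_of_mem _ hk)
    obtain ⟨hn, c, hc⟩ := hl n List.mem_cons_self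
    have hc0 : 0 < c := by
      rcases Nat.eq_zero_or_pos c with h | h
      · subst h; omega
      · exact h
    have h1 : ⌊(n : ℝ) * x⌋₊ = ⌊N * x⌋₊ / c := by
      rw [← Nat.floor_div_natCast]
      congr 1
      have : (c : ℝ) ≠ 0 := by positivity
      rw [hc]; push_cast; field_simp
    have h2 : ⌊N * x⌋₊ / c = n * (⌊N * x⌋₊ / N) + n * (⌊N * x⌋₊ % N) / N := by
      generalize ⌊N * x⌋₊ = j
      conv_lhs => rw [← Nat.div_add_mod j N]
      generalize j / N = u
      generalize j % N = r
      subst hc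
      rw [Nat.mul_div_mul_left _ _ hn, show n * c * u + r = r + c * (n * u) by ring,
        Nat.add_mul_div_left _ _ hc0, add_comm]
    have h3 : ⌊(n : ℝ) * x⌋ = ((⌊(n : ℝ) * x⌋₊ : ℕ) : ℤ) :=
      (Int.natCast_floor_eq_floor (by positivity)).symm
    simp only [List.map_cons, List.sum_cons, ih, h3, h1, h2]
    push_cast
    ring

theorem landau_of_mem_boberSporadicPairs :
    ∀ p ∈ boberSporadicPairs, Landau p.1 p.2 := by
  intro p hp x hx
  have key : ∀ p ∈ boberSporadicPairs, 0 < (p.1 ++ p.2).foldr Nat.lcm 1 ∧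
      (∀ n ∈ p.1 ++ p.2, n ∣ (p.1 ++ p.2).foldr Nat.lcm 1) ∧
      ∀ r < (p.1 ++ p.2).foldr Nat.lcm 1,
        (p.2.map fun n => n * r / (p.1 ++ p.2).foldr Nat.lcm 1).sum ≤
          (p.1.map fun n => n * r / (p.1 ++ p.2).foldr Nat.lcm 1).sum := by
    decide +kernel
  obtain ⟨hN, hd, hr⟩ := key p hp
  obtain ⟨hpos, -, hbal, -⟩ := boberSporadicPairs_spec.2.2 p hp
  revert hN hd hr
  generalize (p.1 ++ p.2).foldr Nat.lcm 1 = N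
  intro hN hd hr
  rw [sum_map_floor hN hx p.1 fun n hn =>
      ⟨hpos n (List.mem_append_left _ hn), hd n (List.mem_append_left _ hn)⟩,
    sum_map_floor hN hx p.2 fun n hn =>
      ⟨hpos n (List.mem_append_right _ hn), hd n (List.mem_append_right _ hn)⟩, hbal, sub_nonneg]
  exact_mod_cast Nat.add_le_add_left (hr _ (Nat.mod_lt _ hN)) _

theorem landau_qBinomial (m n : ℕ) : Landau [m + n] [m, n] := by
  intro x _
  have := Int.le_floor_add ((m : ℝ) * x) (n * x)
  simp only [List.map_cons, List.map_nil, List.sum_cons, List.sum_nil, add_zero, sub_nonneg]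
  push_cast
  rwa [add_mul]

end

noncomputable section

/-! Let `P = ∑ pᵢ qⁱ` be the ratio. Products of `q`-factorials are palindromic, hence so is `P`.
Consecutive coefficients of `(1 + q) P` differ by `pᵢ₊₂ - pᵢ` (by `p₁` at the start), so it remains
to compare coefficients of `P` two apart, up to the middle (`isQRiousUnimodal_of_mul_eq`).

For Gaussian binomials this follows from Sylvester's unimodality theorem. Up to the shift `n.choose
2`, the coefficient of `q ^ s` counts the `n`-subsets of `{0, …, m + n - 1}` of given sum, which is
the dimension of a weight space of `sl₂` on the `n`-th exterior power of its irreducible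
representation of dimension `m + n`. Moving an element to an adjacent free place passes no other
element, so no signs occur, and the square-root normalisation makes raising `E` and lowering `F`
transposes. Then `‖E v‖² = ‖F v‖² + ⟨H v, v⟩` (`sum_raiseSum_sq`) makes `E` injective below the
middle weight, and dimensions increase there.

The sporadic ratios are computed by Kronecker substitution: the coefficients are the base `Q` digits
of the value at a large `Q`, and one integer identity certifies them
(`isQRiousUnimodal_of_checkRatio`). -/

/-! ### Palindromic `q`-factorials and the reduction to coefficients two apart -/

theorem coeff_qNumber (n i : ℕ) : (qNumber n).coeff i = if i < n then 1 else 0 := by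
  simp [qNumber, coeff_X_pow]

theorem natDegree_qNumber_succ (n : ℕ) : (qNumber (n + 1)).natDegree = n := by
  refine natDegree_eq_of_le_of_coeff_ne_zero ?_ (by simp [coeff_qNumber])
  rw [natDegree_le_iff_coeff_eq_zero]
  intro i hi
  rw [coeff_qNumber, if_neg (by omega)]

theorem qNumber_succ_ne_zero (n : ℕ) : qNumber (n + 1) ≠ 0 := by
  intro h
  simpa [coeff_qNumber] using congrArg (fun p => coeff p 0) h

theorem reverse_qNumber_succ (n : ℕ) : (qNumber (n + 1)).reverse = qNumber (n + 1) := by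
  ext i
  rw [coeff_reverse, natDegree_qNumber_succ]
  by_cases h : i ≤ n
  · rw [revAt_le h, coeff_qNumber, coeff_qNumber, if_pos (by omega), if_pos (by omega)]
  · rw [revAt_eq_self_of_lt (by omega)]

theorem qFactorial_zero : qFactorial 0 = 1 := by simp [qFactorial]

theorem qFactorial_succ (n : ℕ) : qFactorial (n + 1) = qFactorial n * qNumber (n + 1) :=
  Finset.prod_range_succ _ _

theorem qFactorial_ne_zero (n : ℕ) : qFactorial n ≠ 0 :=
  Finset.prod_ne_zero_iff.2 fun i _ => qNumber_succ_ne_zero i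

theorem reverse_qFactorial (n : ℕ) : (qFactorial n).reverse = qFactorial n := by
  induction n with
  | zero => simpa [qFactorial_zero] using reverse_C (1 : ℤ)
  | succ n ih => rw [qFactorial_succ, reverse_mul_of_domain, ih, reverse_qNumber_succ]

theorem natDegree_qFactorial (n : ℕ) : (qFactorial n).natDegree = n.choose 2 := by
  induction n with
  | zero => simp [qFactorial_zero]
  | succ n ih =>
    rw [qFactorial_succ, natDegree_mul (qFactorial_ne_zero n) (qNumber_succ_ne_zero n), ih,
      natDegree_qNumber_succ, Nat.choose_succ_succ' n 1, Nat.choose_one_right, add_comm]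

theorem prod_map_qFactorial_ne_zero (l : List ℕ) : (l.map qFactorial).prod ≠ 0 := by
  refine List.prod_ne_zero fun h => ?_
  obtain ⟨n, -, hn⟩ := List.mem_map.1 h
  exact qFactorial_ne_zero n hn

theorem reverse_prod_map_qFactorial (l : List ℕ) :
    (l.map qFactorial).prod.reverse = (l.map qFactorial).prod := by
  induction l with
  | nil => simpa using reverse_C (1 : ℤ)
  | cons n l ih => rw [List.map_cons, List.prod_cons, reverse_mul_of_domain, ih, reverse_qFactorial]

theorem natDegree_prod_map_qFactorial (l : List ℕ) :
    (l.map qFactorial).prod.natDegree = (l.map fun n => n.choose 2).sum := by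
  induction l with
  | nil => simp
  | cons n l ih =>
    rw [List.map_cons, List.prod_cons,
      natDegree_mul (qFactorial_ne_zero n) (prod_map_qFactorial_ne_zero l), ih,
      natDegree_qFactorial, List.map_cons, List.sum_cons]

theorem coeff_eq_coeff_sub_of_reverse_eq {P : ℤ[X]} (h : P.reverse = P) {i : ℕ}
    (hi : i ≤ P.natDegree) : P.coeff i = P.coeff (P.natDegree - i) := by
  conv_lhs => rw [← h, coeff_reverse, revAt_le hi]

/-- If `P` is palindromic, then `(1 + q) P` is unimodal as soon as the coefficients of `P` of equal
parity increase up to the middle. -/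
theorem isSymmUnimodal_one_add_X_mul {P : ℤ[X]} (hP : P ≠ 0) (hrev : P.reverse = P)
    (h1 : 0 ≤ P.coeff 1)
    (h : ∀ i, i + 2 ≤ (P.natDegree + 1) / 2 → P.coeff i ≤ P.coeff (i + 2)) :
    IsSymmUnimodal ((1 + X) * P) := by
  have hX : (1 + X : ℤ[X]) = qNumber 2 := by simp [qNumber, Finset.sum_range_succ]
  have hdeg : ((1 + X) * P).natDegree = P.natDegree + 1 := by
    rw [hX, natDegree_mul (qNumber_succ_ne_zero 1) hP, natDegree_qNumber_succ, add_comm]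
  refine ⟨fun i hi => coeff_eq_coeff_sub_of_reverse_eq ?_ hi, fun i hi => ?_⟩
  · rw [reverse_mul_of_domain, hrev, hX, reverse_qNumber_succ]
  · rw [hdeg] at hi
    rcases i with - | i
    · simp [add_mul, coeff_X_mul, h1]
    · simp only [add_mul, one_mul, coeff_add, coeff_X_mul]
      linarith [h i hi]

/-- Reversal is multiplicative over a domain and fixes both factorial products, so cancelling the
denominator shows that `P` is palindromic. -/
theorem isQRiousUnimodal_of_mul_eq {a b : List ℕ} {P : ℤ[X]}
    (hP : P * (b.map qFactorial).prod = (a.map qFactorial).prod) (h1 : 0 ≤ P.coeff 1)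
    (h : ∀ i, i + 2 ≤ (P.natDegree + 1) / 2 → P.coeff i ≤ P.coeff (i + 2)) :
    IsQRiousUnimodal a b := by
  have hb := prod_map_qFactorial_ne_zero b
  refine ⟨P, ?_, isSymmUnimodal_one_add_X_mul ?_ ?_ h1 h⟩
  · have hb' : algebraMap ℤ[X] (RatFunc ℤ) (b.map qFactorial).prod ≠ 0 :=
      fun h0 => hb (RatFunc.algebraMap_injective ℤ (by rw [h0, map_zero]))
    rw [qFactorialRatio, eq_div_iff hb', ← map_mul, hP]
  · rintro rfl
    exact prod_map_qFactorial_ne_zero a (by rw [← hP, zero_mul])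
  · apply mul_right_cancel₀ hb
    conv_lhs => rw [← reverse_prod_map_qFactorial b]
    rw [← reverse_mul_of_domain, hP, reverse_prod_map_qFactorial]

theorem natDegree_add_of_mul_eq {a b : List ℕ} {P : ℤ[X]}
    (hP : P * (b.map qFactorial).prod = (a.map qFactorial).prod) :
    P.natDegree + (b.map fun n => n.choose 2).sum = (a.map fun n => n.choose 2).sum := by
  have h0 : P ≠ 0 := by
    rintro rfl
    exact prod_map_qFactorial_ne_zero a (by rw [← hP, zero_mul])
  rw [← natDegree_prod_map_qFactorial, ← natDegree_prod_map_qFactorial, ← hP,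
    natDegree_mul h0 (prod_map_qFactorial_ne_zero b)]

/-! ### Gaussian binomials as generating functions of subset sums -/

/-- Sum over the `n`-element subsets of `{0, …, N - 1}` of `q` to the power of their sum. -/
def subsetSumPoly (N n : ℕ) : ℤ[X] :=
  ∑ S ∈ (Finset.range N).powersetCard n, X ^ ∑ i ∈ S, i

/-- The two terms collect the subsets that omit `N` and those that contain it. -/
theorem subsetSumPoly_succ (N n : ℕ) :
    subsetSumPoly (N + 1) (n + 1) = subsetSumPoly N (n + 1) + X ^ N * subsetSumPoly N n := by
  have hN : N ∉ Finset.range N := by simp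
  rw [subsetSumPoly, Finset.range_add_one, Finset.powersetCard_succ_insert hN, Finset.sum_union]
  · congr 1
    rw [Finset.sum_image, subsetSumPoly, Finset.mul_sum]
    · refine Finset.sum_congr rfl fun S hS => ?_
      have hS' : N ∉ S := fun h => hN ((Finset.mem_powersetCard.1 hS).1 h)
      rw [Finset.sum_insert hS', pow_add]
    · intro S hS T hT h
      have hS' : N ∉ S := fun h => hN ((Finset.mem_powersetCard.1 hS).1 h)
      have hT' : N ∉ T := fun h => hN ((Finset.mem_powersetCard.1 hT).1 h)
      simpa [Finset.erase_insert hS', Finset.erase_insert hT'] using congrArg (·.erase N) h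
  · rw [Finset.disjoint_left]
    intro S hS hS'
    obtain ⟨T, -, rfl⟩ := Finset.mem_image.1 hS'
    exact hN ((Finset.mem_powersetCard.1 hS).1 (Finset.mem_insert_self N T))

theorem coeff_subsetSumPoly (N n s : ℕ) : (subsetSumPoly N n).coeff s =
    (((Finset.range N).powersetCard n).filter fun S => ∑ i ∈ S, i = s).card := by
  simp only [subsetSumPoly, finsetSum_coeff, coeff_X_pow, Finset.card_filter]
  push_cast
  exact Finset.sum_congr rfl fun S _ => by simp only [eq_comm]

/-- The Gaussian binomial coefficient `[m + n]! / ([m]! [n]!)`. -/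
def qBinomial : ℕ → ℕ → ℤ[X]
  | 0, _ => 1
  | _ + 1, 0 => 1
  | m + 1, n + 1 => qBinomial m (n + 1) + X ^ (m + 1) * qBinomial (m + 1) n

theorem qBinomial_zero_right (m : ℕ) : qBinomial m 0 = 1 := by cases m <;> simp [qBinomial]

theorem qNumber_add (m n : ℕ) : qNumber (m + n) = qNumber m + X ^ m * qNumber n := by
  simp [qNumber, Finset.sum_range_add, Finset.mul_sum, pow_add]

theorem qBinomial_mul (m n : ℕ) :
    qBinomial m n * (qFactorial m * qFactorial n) = qFactorial (m + n) := by
  induction m generalizing n with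
  | zero => simp [qBinomial, qFactorial_zero]
  | succ m ihm =>
    induction n with
    | zero => simp [qBinomial, qFactorial_zero]
    | succ n ihn =>
      have h1 := ihm (n + 1)
      rw [qFactorial_succ n, show m + (n + 1) = m + 1 + n by omega] at h1
      rw [qFactorial_succ m] at ihn
      rw [qBinomial, ← add_assoc, qFactorial_succ (m + 1 + n), add_assoc (m + 1) n 1,
        qNumber_add (m + 1) (n + 1), qFactorial_succ m, qFactorial_succ n]
      linear_combination qNumber (m + 1) * h1 + X ^ (m + 1) * qNumber (n + 1) * ihn

theorem subsetSumPoly_eq_zero {N n : ℕ} (h : N < n) : subsetSumPoly N n = 0 := by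
  rw [subsetSumPoly, Finset.powersetCard_eq_empty.2 (by simpa using h), Finset.sum_empty]

/-- Both sides obey the same Pascal recurrence; `n.choose 2` is the least possible sum `0 + ⋯ + (n -
1)`. -/
theorem subsetSumPoly_eq (m n : ℕ) :
    subsetSumPoly (m + n) n = X ^ n.choose 2 * qBinomial m n := by
  induction n generalizing m with
  | zero => simp [subsetSumPoly, qBinomial_zero_right]
  | succ n ihn =>
    have hc : (n + 1).choose 2 = n + n.choose 2 := by
      rw [Nat.choose_succ_succ' n 1, Nat.choose_one_right]
    induction m with
    | zero =>
      have := ihn 0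
      rw [zero_add] at this
      rw [zero_add, subsetSumPoly_succ, subsetSumPoly_eq_zero (Nat.lt_succ_self n), this, hc]
      simp only [qBinomial]
      ring
    | succ m ihm =>
      have := ihn (m + 1)
      rw [← add_assoc, subsetSumPoly_succ, this, show m + 1 + n = m + (n + 1) by omega, ihm,
        qBinomial, hc]
      ring

theorem coeff_qBinomial (m n s : ℕ) : (qBinomial m n).coeff s =
    (((Finset.range (m + n)).powersetCard n).filter
      fun S => ∑ i ∈ S, i = s + n.choose 2).card := by
  rw [← coeff_subsetSumPoly, subsetSumPoly_eq, coeff_X_pow_mul]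

/-! ### Raising and lowering operators of `sl₂` on subsets -/

/-- The set `S` with the roles of `i` and `i + 1` exchanged. -/
def swapNext (i : ℕ) (S : Finset ℕ) : Finset ℕ := S.map (Equiv.swap i (i + 1)).toEmbedding

theorem mem_swapNext {i x : ℕ} {S : Finset ℕ} : x ∈ swapNext i S ↔ Equiv.swap i (i + 1) x ∈ S := by
  rw [swapNext, Finset.mem_map_equiv, Equiv.symm_swap]

theorem self_mem_swapNext {i : ℕ} {S : Finset ℕ} : i ∈ swapNext i S ↔ i + 1 ∈ S := by
  rw [mem_swapNext, Equiv.swap_apply_left]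

theorem succ_mem_swapNext {i : ℕ} {S : Finset ℕ} : i + 1 ∈ swapNext i S ↔ i ∈ S := by
  rw [mem_swapNext, Equiv.swap_apply_right]

theorem mem_swapNext_of_ne {i x : ℕ} {S : Finset ℕ} (h : x ≠ i) (h' : x ≠ i + 1) :
    x ∈ swapNext i S ↔ x ∈ S := by
  rw [mem_swapNext, Equiv.swap_apply_of_ne_of_ne h h']

theorem swapNext_swapNext (i : ℕ) (S : Finset ℕ) : swapNext i (swapNext i S) = S := by
  ext x
  rw [mem_swapNext, mem_swapNext, Equiv.swap_apply_self]

theorem swapNext_comm {i j : ℕ} (h : i ≠ j) (h1 : i + 1 ≠ j) (h2 : j + 1 ≠ i) (S : Finset ℕ) :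
    swapNext i (swapNext j S) = swapNext j (swapNext i S) := by
  ext x
  simp only [mem_swapNext, Equiv.swap_apply_def]
  split_ifs <;> first | rfl | (exfalso; omega)

theorem swapNext_mem_powersetCard {N n i : ℕ} (hi : i + 1 < N) {S : Finset ℕ}
    (hS : S ∈ (Finset.range N).powersetCard n) :
    swapNext i S ∈ (Finset.range N).powersetCard n := by
  rw [Finset.mem_powersetCard] at hS ⊢
  refine ⟨fun x hx => ?_, by rw [swapNext, Finset.card_map, hS.2]⟩
  have := hS.1 (mem_swapNext.1 hx)
  rw [Finset.mem_range, Equiv.swap_apply_def] at this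
  rw [Finset.mem_range]
  split_ifs at this <;> omega

theorem sum_swapNext {i : ℕ} {S : Finset ℕ} (h : i + 1 ∈ S) (h' : i ∉ S) :
    ∑ x ∈ S, x = ∑ x ∈ swapNext i S, x + 1 := by
  have e : swapNext i S = insert i (S.erase (i + 1)) := by
    ext x
    simp only [mem_swapNext, Finset.mem_insert, Finset.mem_erase, Equiv.swap_apply_def]
    split_ifs with h1 h2
    · simp [h1, h]
    · subst h2; simp [h']
    · simp [h1, h2]
  rw [e, Finset.sum_insert (by simp [h']), ← Finset.add_sum_erase S (fun x => x) h]
  ring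

/-- The operator moving the element `i` of a set up to `i + 1`. -/
def raise (i : ℕ) (v : Finset ℕ → ℝ) (S : Finset ℕ) : ℝ :=
  if i + 1 ∈ S ∧ i ∉ S then v (swapNext i S) else 0

/-- The operator moving the element `i + 1` of a set down to `i`. -/
def lower (i : ℕ) (v : Finset ℕ → ℝ) (S : Finset ℕ) : ℝ :=
  if i ∈ S ∧ i + 1 ∉ S then v (swapNext i S) else 0

/-- Adjointness: `swapNext i` is an involution of the `n`-subsets that interchanges the conditions
in `raise` and `lower`. -/
theorem sum_raise_mul {N n i : ℕ} (hi : i + 1 < N) (u v : Finset ℕ → ℝ) :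
    ∑ S ∈ (Finset.range N).powersetCard n, raise i u S * v S =
      ∑ S ∈ (Finset.range N).powersetCard n, u S * lower i v S := by
  refine Finset.sum_nbij' (swapNext i) (swapNext i)
    (fun S hS => swapNext_mem_powersetCard hi hS) (fun S hS => swapNext_mem_powersetCard hi hS)
    (fun S _ => swapNext_swapNext i S) (fun S _ => swapNext_swapNext i S) fun S _ => ?_
  simp only [raise, lower, self_mem_swapNext, succ_mem_swapNext, swapNext_swapNext]
  split_ifs <;> simp

/-- For adjacent `i`, `j` the two moves make contradictory demands on their common place and both
sides vanish; for distant ones the swaps commute. -/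
theorem lower_raise_comm {i j : ℕ} (h : i ≠ j) (v : Finset ℕ → ℝ) (S : Finset ℕ) :
    lower i (raise j v) S = raise j (lower i v) S := by
  simp only [lower, raise, ← ite_and]
  rcases eq_or_ne (i + 1) j with rfl | h1
  · rw [if_neg, if_neg]
    · rintro ⟨⟨h1, h2⟩, h3, h4⟩
      exact h4 (self_mem_swapNext.2 h1)
    · rintro ⟨⟨h1, h2⟩, h3, h4⟩
      exact h4 (succ_mem_swapNext.2 h1)
  rcases eq_or_ne (j + 1) i with rfl | h2
  · rw [if_neg, if_neg]
    · rintro ⟨⟨h1, h2⟩, h3, h4⟩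
      exact h2 (succ_mem_swapNext.1 h3)
    · rintro ⟨⟨h1, h2⟩, h3, h4⟩
      exact h2 (self_mem_swapNext.1 h3)
  · rw [swapNext_comm h h1 h2]
    refine if_congr ?_ rfl rfl
    rw [mem_swapNext_of_ne h2 (by omega), mem_swapNext_of_ne h.symm h1.symm,
      mem_swapNext_of_ne h h2.symm, mem_swapNext_of_ne h1 (by omega)]
    tauto

theorem lower_raise_self (i : ℕ) (v : Finset ℕ → ℝ) (S : Finset ℕ) :
    lower i (raise i v) S = raise i (lower i v) S +
      ((if i ∈ S then 1 else 0) - (if i + 1 ∈ S then 1 else 0)) * v S := by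
  simp only [lower, raise, self_mem_swapNext, succ_mem_swapNext, swapNext_swapNext]
  by_cases h : i ∈ S <;> by_cases h' : i + 1 ∈ S <;> simp [h, h']

theorem sum_raise_mul_raise {N n i j : ℕ} (hi : i + 1 < N) (hj : j + 1 < N) (v : Finset ℕ → ℝ) :
    ∑ S ∈ (Finset.range N).powersetCard n, raise i v S * raise j v S =
      ∑ S ∈ (Finset.range N).powersetCard n, (lower i v S * lower j v S +
        if i = j then ((if i ∈ S then 1 else 0) - (if i + 1 ∈ S then 1 else 0)) * v S ^ 2
        else 0) := by
  rw [sum_raise_mul hi, Finset.sum_add_distrib]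
  have h := sum_raise_mul (n := n) hj (lower i v) v
  have h' : ∑ S ∈ (Finset.range N).powersetCard n, lower i v S * lower j v S =
      ∑ S ∈ (Finset.range N).powersetCard n, raise j (lower i v) S * v S := h.symm
  rw [h', ← Finset.sum_add_distrib]
  refine Finset.sum_congr rfl fun S _ => ?_
  by_cases hij : i = j
  · subst hij
    rw [if_pos rfl, lower_raise_self]
    ring
  · rw [if_neg hij, lower_raise_comm hij]
    ring

/-- Summation by parts: `(i + 1)(N - 1 - i) - i(N - i) = N - 1 - 2i`, so the sum is the `H`-weight
`∑ (N - 1 - 2x)` over `x ∈ S`. -/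
theorem sum_mul_indicator_sub {N : ℕ} {S : Finset ℕ} (hS : S ⊆ Finset.range N) :
    ∑ i ∈ Finset.range (N - 1), ((i : ℝ) + 1) * (N - 1 - i) *
      ((if i ∈ S then 1 else 0) - (if i + 1 ∈ S then 1 else 0)) =
      S.card * (N - 1) - 2 * ∑ x ∈ S, (x : ℝ) := by
  rcases N with - | N
  · simp [Finset.subset_empty.1 (by simpa using hS)]
  -- Here `N` stands for the original `N - 1`; the boundary term has a factor `N - M` and disappears
  -- at `M = N`.
  have h : ∀ M : ℕ, ∑ i ∈ Finset.range M, ((i : ℝ) + 1) * (N - i) *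
      ((if i ∈ S then 1 else 0) - (if i + 1 ∈ S then 1 else 0)) =
      ∑ i ∈ Finset.range (M + 1), (if i ∈ S then ((N : ℝ) - 2 * i) else 0) -
        (if M ∈ S then ((M : ℝ) + 1) * (N - M) else 0) := by
    intro M
    induction M with
    | zero => by_cases h : 0 ∈ S <;> simp [h]
    | succ M ih =>
      rw [Finset.sum_range_succ, ih, Finset.sum_range_succ _ (M + 1)]
      push_cast
      by_cases h : M ∈ S <;> by_cases h' : M + 1 ∈ S <;> simp [h, h'] <;> ring
  have := h N
  simp only [Nat.cast_add, Nat.cast_one, add_sub_cancel_right, Nat.add_sub_cancel]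
  rw [this, sub_self, mul_zero, ite_self, sub_zero, ← Finset.sum_filter,
    Finset.filter_mem_eq_inter, Finset.inter_eq_right.2 hS, Finset.sum_sub_distrib,
    Finset.sum_const, nsmul_eq_mul, Finset.mul_sum]

/-- The matrix entry `√((i + 1) (N - 1 - i))` of the raising operator of `sl₂` acting on its
`N`-dimensional irreducible representation. -/
def raiseCoeff (N i : ℕ) : ℝ := √(((i : ℝ) + 1) * (N - 1 - i))

theorem raiseCoeff_mul_self {N i : ℕ} (h : i ∈ Finset.range (N - 1)) :
    raiseCoeff N i * raiseCoeff N i = ((i : ℝ) + 1) * (N - 1 - i) := by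
  refine Real.mul_self_sqrt (mul_nonneg (by positivity) ?_)
  have : i + 1 ≤ N := by have := Finset.mem_range.1 h; omega
  have : ((i + 1 : ℕ) : ℝ) ≤ N := by exact_mod_cast this
  push_cast at this
  linarith

/-- The raising operator of `sl₂` on the exterior powers of its `N`-dimensional irreducible
representation. -/
def raiseSum (N : ℕ) (v : Finset ℕ → ℝ) (S : Finset ℕ) : ℝ :=
  ∑ i ∈ Finset.range (N - 1), raiseCoeff N i * raise i v S

/-- The lowering operator of `sl₂` on the exterior powers of its `N`-dimensional irreducible
representation. -/
def lowerSum (N : ℕ) (v : Finset ℕ → ℝ) (S : Finset ℕ) : ℝ :=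
  ∑ i ∈ Finset.range (N - 1), raiseCoeff N i * lower i v S

/-- Expanding the squares, the off-diagonal terms agree by commutation, and the diagonal commutators
add up to the weight. -/
theorem sum_raiseSum_sq (N n : ℕ) (v : Finset ℕ → ℝ) :
    ∑ S ∈ (Finset.range N).powersetCard n, raiseSum N v S ^ 2 =
      ∑ S ∈ (Finset.range N).powersetCard n, lowerSum N v S ^ 2 +
        ∑ S ∈ (Finset.range N).powersetCard n,
          ((n : ℝ) * (N - 1) - 2 * ∑ x ∈ S, (x : ℝ)) * v S ^ 2 := by
  set U := (Finset.range N).powersetCard n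
  set R := Finset.range (N - 1)
  have expand : ∀ f : ℕ → Finset ℕ → ℝ,
      ∑ S ∈ U, (∑ i ∈ R, raiseCoeff N i * f i S) ^ 2 =
        ∑ i ∈ R, ∑ j ∈ R, raiseCoeff N i * raiseCoeff N j * ∑ S ∈ U, f i S * f j S := by
    intro f
    simp only [sq, Finset.sum_mul_sum]
    rw [Finset.sum_comm]
    refine Finset.sum_congr rfl fun i _ => ?_
    rw [Finset.sum_comm]
    refine Finset.sum_congr rfl fun j _ => ?_
    rw [Finset.mul_sum]
    exact Finset.sum_congr rfl fun S _ => by ring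
  simp only [raiseSum, lowerSum]
  rw [expand, expand]
  have hd : ∑ S ∈ U, ((n : ℝ) * (N - 1) - 2 * ∑ x ∈ S, (x : ℝ)) * v S ^ 2 =
      ∑ i ∈ R, ∑ j ∈ R, raiseCoeff N i * raiseCoeff N j * ∑ S ∈ U,
        if i = j then ((if i ∈ S then 1 else 0) - (if i + 1 ∈ S then 1 else 0)) * v S ^ 2
        else 0 := by
    have : ∀ S ∈ U, ((n : ℝ) * (N - 1) - 2 * ∑ x ∈ S, (x : ℝ)) * v S ^ 2 =
        ∑ i ∈ R, ((i : ℝ) + 1) * (N - 1 - i) *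
          ((if i ∈ S then 1 else 0) - (if i + 1 ∈ S then 1 else 0)) * v S ^ 2 := by
      intro S hS
      obtain ⟨hS, hc⟩ := Finset.mem_powersetCard.1 hS
      rw [← Finset.sum_mul, sum_mul_indicator_sub hS, hc]
    rw [Finset.sum_congr rfl this, Finset.sum_comm]
    refine Finset.sum_congr rfl fun i hi => ?_
    rw [Finset.sum_eq_single i]
    · rw [raiseCoeff_mul_self hi, Finset.mul_sum]
      exact Finset.sum_congr rfl fun S _ => by rw [if_pos rfl, mul_assoc]
    · intro j _ hj
      rw [Finset.sum_eq_zero fun S _ => if_neg hj.symm, mul_zero]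
    · exact fun h => absurd hi h
  rw [hd, ← Finset.sum_add_distrib]
  refine Finset.sum_congr rfl fun i hi => ?_
  rw [← Finset.sum_add_distrib]
  refine Finset.sum_congr rfl fun j hj => ?_
  have hi' := Finset.mem_range.1 hi
  have hj' := Finset.mem_range.1 hj
  rw [sum_raise_mul_raise (by omega) (by omega), Finset.sum_add_distrib, mul_add]

/-! ### Injectivity below the middle weight and Sylvester's theorem -/

/-- The `n`-element subsets of `{0, …, N - 1}` with sum `s`. -/
def subsetsOfSum (N n s : ℕ) : Finset (Finset ℕ) :=
  ((Finset.range N).powersetCard n).filter fun S => ∑ i ∈ S, i = s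

/-- On vectors supported on sum `s`, `H` is the positive scalar `n (N - 1) - 2 s`. If `E v = 0`, the
norm identity writes zero as `‖F v‖²` plus a positive multiple of `‖v‖²`. -/
theorem eq_zero_of_raiseSum_eq_zero {N n s : ℕ} (hs : 2 * s < n * (N - 1)) {v : Finset ℕ → ℝ}
    (hv : ∀ S, ∑ x ∈ S, x ≠ s → v S = 0)
    (h : ∀ S ∈ (Finset.range N).powersetCard n, raiseSum N v S = 0) {S : Finset ℕ}
    (hS : S ∈ (Finset.range N).powersetCard n) : v S = 0 := by
  have key := sum_raiseSum_sq N n v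
  rw [Finset.sum_eq_zero fun S hS => by rw [h S hS, sq, zero_mul]] at key
  have hN : 1 ≤ N := by
    by_contra hN
    have : N - 1 = 0 := by omega
    simp [this] at hs
  have hs' : 0 < (n : ℝ) * (N - 1) - 2 * s := by
    have : ((2 * s : ℕ) : ℝ) < ((n * (N - 1) : ℕ) : ℝ) := by exact_mod_cast hs
    push_cast [Nat.cast_sub hN] at this
    linarith
  have hterm : ∀ S : Finset ℕ, ((n : ℝ) * (N - 1) - 2 * ∑ x ∈ S, (x : ℝ)) * v S ^ 2 =
      ((n : ℝ) * (N - 1) - 2 * s) * v S ^ 2 := by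
    intro S
    by_cases hSs : ∑ x ∈ S, x = s
    · rw [← hSs]
      push_cast
      rfl
    · simp [hv S hSs]
  simp only [hterm] at key
  have h1 : 0 ≤ ∑ S ∈ (Finset.range N).powersetCard n, lowerSum N v S ^ 2 :=
    Finset.sum_nonneg fun S _ => sq_nonneg _
  have h2 := Finset.single_le_sum (f := fun S => ((n : ℝ) * (N - 1) - 2 * s) * v S ^ 2)
    (fun S _ => mul_nonneg hs'.le (sq_nonneg (v S))) hS
  have h3 : ((n : ℝ) * (N - 1) - 2 * s) * v S ^ 2 ≤ 0 := by
    linarith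
  have h4 : v S ^ 2 ≤ 0 := by
    by_contra h4
    exact absurd h3 (not_le.2 (mul_pos hs' (not_le.1 h4)))
  exact pow_eq_zero_iff two_ne_zero |>.1 (le_antisymm h4 (sq_nonneg _))

/-- The extension by zero of a function on `subsetsOfSum N n s`. -/
def extendByZero {N n s : ℕ} (w : subsetsOfSum N n s → ℝ) (S : Finset ℕ) : ℝ :=
  if h : S ∈ subsetsOfSum N n s then w ⟨S, h⟩ else 0

/-- The raising operator between consecutive weight spaces. -/
def raiseLevel (N n s : ℕ) : (subsetsOfSum N n s → ℝ) →ₗ[ℝ] (subsetsOfSum N n (s + 1) → ℝ) where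
  toFun w T := raiseSum N (extendByZero w) T
  map_add' w w' := by
    ext T
    simp only [raiseSum, Pi.add_apply, ← Finset.sum_add_distrib, ← mul_add]
    refine Finset.sum_congr rfl fun i _ => ?_
    congr 1
    simp only [raise, extendByZero]
    split_ifs <;> simp
  map_smul' c w := by
    ext T
    simp only [raiseSum, Pi.smul_apply, smul_eq_mul, RingHom.id_apply, Finset.mul_sum]
    refine Finset.sum_congr rfl fun i _ => ?_
    rw [mul_left_comm]
    congr 1
    simp only [raise, extendByZero]
    split_ifs <;> simp

theorem raiseLevel_injective {N n s : ℕ} (hs : 2 * s < n * (N - 1)) :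
    Function.Injective (raiseLevel N n s) := by
  rw [injective_iff_map_eq_zero]
  intro w hw
  have hv : ∀ S, ∑ x ∈ S, x ≠ s → extendByZero w S = 0 := by
    intro S hS
    rw [extendByZero, dif_neg]
    exact fun h => hS (Finset.mem_filter.1 h).2
  ext ⟨S, hS⟩
  have h0 : extendByZero w S = 0 := by
    refine eq_zero_of_raiseSum_eq_zero hs hv (fun T hT => ?_) (Finset.mem_filter.1 hS).1
    by_cases hTs : ∑ x ∈ T, x = s + 1
    · exact congrFun hw ⟨T, Finset.mem_filter.2 ⟨hT, hTs⟩⟩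
    -- Each term evaluates the vector at a set whose sum is one less than that of `T`, hence not
    -- `s`.
    · refine Finset.sum_eq_zero fun i _ => ?_
      rw [raise]
      split_ifs with h
      · rw [hv, mul_zero]
        have := sum_swapNext h.1 h.2
        omega
      · rw [mul_zero]
  simpa [extendByZero, hS] using h0

theorem card_subsetsOfSum_le {N n s : ℕ} (hs : 2 * s < n * (N - 1)) :
    (subsetsOfSum N n s).card ≤ (subsetsOfSum N n (s + 1)).card := by
  simpa using LinearMap.finrank_le_finrank_of_injective (raiseLevel_injective hs)

theorem add_choose_two (m n : ℕ) :
    (m + n).choose 2 = m.choose 2 + n.choose 2 + m * n := by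
  induction n with
  | zero => simp
  | succ n ih =>
    rw [← add_assoc, Nat.choose_succ_succ' (m + n) 1, Nat.choose_succ_succ' n 1, ih,
      Nat.choose_one_right, Nat.choose_one_right]
    ring

/-- Sylvester's theorem: Gaussian binomial coefficients are unimodal. -/
theorem coeff_qBinomial_le_coeff_succ {m n s : ℕ} (hs : 2 * s < m * n) :
    (qBinomial m n).coeff s ≤ (qBinomial m n).coeff (s + 1) := by
  rw [coeff_qBinomial, coeff_qBinomial, Nat.cast_le, add_right_comm]
  -- After the shift by `n.choose 2`, the bound `2 (s + n.choose 2) < n (m + n - 1)` is exactly `2 s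
  -- < m n`.
  refine card_subsetsOfSum_le (N := m + n) (n := n) ?_
  have hn : n.choose 2 * 2 = n * (n - 1) := by
    rw [Nat.choose_two_right, Nat.div_mul_cancel (Nat.even_mul_pred_self n).two_dvd]
  rcases n with - | n
  · simp at hs
  · rw [show m + (n + 1) - 1 = m + n by omega]
    rw [Nat.add_sub_cancel] at hn
    nlinarith

theorem isQRiousUnimodal_qBinomial (m n : ℕ) : IsQRiousUnimodal [m + n] [m, n] := by
  have hmul : qBinomial m n * (([m, n] : List ℕ).map qFactorial).prod =
      (([m + n] : List ℕ).map qFactorial).prod := by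
    simpa using qBinomial_mul m n
  have hdeg : (qBinomial m n).natDegree = m * n := by
    have h := natDegree_add_of_mul_eq hmul
    simp only [List.map_cons, List.map_nil, List.sum_cons, List.sum_nil, add_zero,
      add_choose_two] at h
    omega
  refine isQRiousUnimodal_of_mul_eq hmul ?_ fun i hi => ?_
  · rw [coeff_qBinomial]
    positivity
  · rw [hdeg] at hi
    -- The second step needs `2 (i + 1) < m n`, which `i + 2 ≤ (m n + 1) / 2` provides.
    exact (coeff_qBinomial_le_coeff_succ (by omega)).trans
      (coeff_qBinomial_le_coeff_succ (by omega))

/-! ### Kronecker substitution and the sporadic pairs -/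

/-- The coefficients are natural numbers with sum `p.eval 1 < Q`, so each is a single base `Q` digit
and nothing carries. -/
theorem coeff_eq_eval_div_pow_mod {p : ℕ[X]} {Q : ℕ} (hp : p.eval 1 < Q) (i : ℕ) :
    p.coeff i = p.eval Q / Q ^ i % Q := by
  have hQ : 0 < Q := by omega
  induction i generalizing p with
  | zero =>
    have h1 : p.eval 1 = p.divX.eval 1 + p.coeff 0 := by
      conv_lhs => rw [← divX_mul_X_add p]
      simp
    have h2 : p.eval Q = p.divX.eval Q * Q + p.coeff 0 := by
      conv_lhs => rw [← divX_mul_X_add p]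
      simp
    rw [h2, pow_zero, Nat.div_one, Nat.mul_add_mod', Nat.mod_eq_of_lt (by omega)]
  | succ i ih =>
    have h1 : p.eval 1 = p.divX.eval 1 + p.coeff 0 := by
      conv_lhs => rw [← divX_mul_X_add p]
      simp
    have h2 : p.eval Q = p.coeff 0 + p.divX.eval Q * Q := by
      conv_lhs => rw [← divX_mul_X_add p]
      simp [add_comm]
    rw [← coeff_divX, ih (by omega), pow_succ', ← Nat.div_div_eq_div_mul, h2,
      Nat.add_mul_div_right _ _ hQ, Nat.div_eq_of_lt (show p.coeff 0 < Q by omega), zero_add]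

/-- Kronecker substitution. -/
theorem eq_of_eval_eq_of_eval_one_lt {p r : ℕ[X]} {Q : ℕ} (hp : p.eval 1 < Q) (hr : r.eval 1 < Q)
    (h : p.eval Q = r.eval Q) : p = r := by
  ext i
  rw [coeff_eq_eval_div_pow_mod hp, coeff_eq_eval_div_pow_mod hr, h]

/-- The value `[n]` at `q = Q`. -/
def qNumberAt (Q : ℕ) : ℕ → ℕ
  | 0 => 0
  | n + 1 => Q * qNumberAt Q n + 1

/-- The value `[n]!` at `q = Q`. -/
def qFactorialAt (Q : ℕ) : ℕ → ℕ
  | 0 => 1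
  | n + 1 => qFactorialAt Q n * qNumberAt Q (n + 1)

/-- The `q`-factorial with coefficients in `ℕ`. -/
def qFactorialNat (n : ℕ) : ℕ[X] := ∏ i ∈ Finset.range n, ∑ j ∈ Finset.range (i + 1), X ^ j

theorem map_qFactorialNat (n : ℕ) : (qFactorialNat n).map (Nat.castRingHom ℤ) = qFactorial n := by
  simp [qFactorialNat, qFactorial, qNumber, Polynomial.map_prod, Polynomial.map_sum]

theorem qNumberAt_eq (Q n : ℕ) : qNumberAt Q n = ∑ j ∈ Finset.range n, Q ^ j := by
  induction n with
  | zero => rfl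
  | succ n ih => rw [qNumberAt, ih, Finset.sum_range_succ', Finset.mul_sum]; simp [pow_succ']

theorem eval_qFactorialNat (Q n : ℕ) : (qFactorialNat n).eval Q = qFactorialAt Q n := by
  induction n with
  | zero => simp [qFactorialNat, qFactorialAt]
  | succ n ih =>
    rw [qFactorialAt, ← ih, qFactorialNat, Finset.prod_range_succ, eval_mul, qNumberAt_eq]
    simp [qFactorialNat, eval_finsetSum]

/-- The value of `[l₁]! ⋯ [lᵣ]!` at `q = Q`. -/
def qFactorialProdAt (Q : ℕ) : List ℕ → ℕ
  | [] => 1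
  | n :: l => qFactorialAt Q n * qFactorialProdAt Q l

theorem eval_prod_map_qFactorialNat (Q : ℕ) (l : List ℕ) :
    (l.map qFactorialNat).prod.eval Q = qFactorialProdAt Q l := by
  induction l with
  | nil => simp [qFactorialProdAt]
  | cons n l ih => simp [qFactorialProdAt, ih, eval_qFactorialNat]

theorem map_prod_map_qFactorialNat (l : List ℕ) :
    (l.map qFactorialNat).prod.map (Nat.castRingHom ℤ) = (l.map qFactorial).prod := by
  induction l with
  | nil => simp
  | cons n l ih => simp [ih, map_qFactorialNat]

/-- The first `k` base `Q` digits of `N`, least significant first. -/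
def digitList (Q : ℕ) : ℕ → ℕ → List ℕ
  | 0, _ => []
  | k + 1, N => N % Q :: digitList Q k (N / Q)

/-- The polynomial with the given coefficients. -/
def ofCoeffList : List ℕ → ℕ[X]
  | [] => 0
  | c :: l => C c + X * ofCoeffList l

theorem coeff_ofCoeffList (l : List ℕ) (i : ℕ) : (ofCoeffList l).coeff i = l.getD i 0 := by
  induction l generalizing i with
  | nil => simp [ofCoeffList]
  | cons c l ih => cases i <;> simp [ofCoeffList, ih]

theorem eval_one_ofCoeffList (l : List ℕ) : (ofCoeffList l).eval 1 = l.sum := by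
  induction l with
  | nil => simp [ofCoeffList]
  | cons c l ih => simp [ofCoeffList, ih]

theorem eval_ofCoeffList_digitList (Q k N : ℕ) :
    (ofCoeffList (digitList Q k N)).eval Q = N % Q ^ k := by
  induction k generalizing N with
  | zero => simp [digitList, ofCoeffList, Nat.mod_one]
  | succ k ih => simp [digitList, ofCoeffList, ih, pow_succ', Nat.mod_mul]

/-- In the first `k + 2` entries of the list each is at most the next but one. -/
def parityMonotone : ℕ → List ℕ → Bool
  | 0, _ => true
  | k + 1, c :: d :: e :: l => Nat.ble c e && parityMonotone k (d :: e :: l)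
  | _ + 1, _ => false

theorem getD_le_of_parityMonotone {k : ℕ} {l : List ℕ} (h : parityMonotone k l) {i : ℕ}
    (hi : i < k) : l.getD i 0 ≤ l.getD (i + 2) 0 := by
  induction k generalizing l i with
  | zero => omega
  | succ k ih =>
    match l, h with
    | c :: d :: e :: l, h =>
      simp only [parityMonotone, Bool.and_eq_true, Nat.ble_eq] at h
      cases i with
      | zero => simpa using h.1
      | succ i => simpa using ih h.2 (by omega)

/-- `L` is the coefficient list of the `q`-factorial ratio, verified at `q = Q`, and it satisfies
the inequalities that make `(1 + q) D(a, b; q)` unimodal. -/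
def checkCoeffs (Q k : ℕ) (a b : List ℕ) (N : ℕ) (L : List ℕ) : Bool :=
  Nat.beq (N * qFactorialProdAt Q b) (qFactorialProdAt Q a) && Nat.ble (N + 1) (Q ^ (k + 1)) &&
    Nat.ble (L.sum * qFactorialProdAt 1 b + 1) Q && Nat.ble (qFactorialProdAt 1 a + 1) Q &&
    parityMonotone ((k + 1) / 2 - 1) L

/-- The degree of the `q`-factorial ratio. -/
def qFactorialRatioDegree (a b : List ℕ) : ℕ :=
  (a.map fun n => n.choose 2).sum - (b.map fun n => n.choose 2).sum

/-- Checks the coefficients of the `q`-factorial ratio, read off as the digits of its value at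
`q = Q`. -/
def checkRatio (Q : ℕ) (a b : List ℕ) : Bool :=
  let k := qFactorialRatioDegree a b
  let N := qFactorialProdAt Q a / qFactorialProdAt Q b
  checkCoeffs Q k a b N (digitList Q (k + 1) N)

theorem isQRiousUnimodal_of_checkRatio {Q : ℕ} {a b : List ℕ} (h : checkRatio Q a b) :
    IsQRiousUnimodal a b := by
  unfold checkRatio at h
  extract_lets k N at h
  simp only [checkCoeffs, Bool.and_eq_true, Nat.beq_eq, Nat.ble_eq, Nat.succ_le_iff] at h
  obtain ⟨⟨⟨⟨hmul, hN⟩, hb⟩, ha⟩, hmono⟩ := h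
  set L := digitList Q (k + 1) N with hL
  have key : ofCoeffList L * (b.map qFactorialNat).prod = (a.map qFactorialNat).prod := by
    apply eq_of_eval_eq_of_eval_one_lt (Q := Q)
    · rw [eval_mul, eval_one_ofCoeffList]
      rwa [show eval 1 _ = _ from eval_prod_map_qFactorialNat 1 b]
    · rwa [show eval 1 _ = _ from eval_prod_map_qFactorialNat 1 a]
    -- Since `N < Q ^ (k + 1)`, the `k + 1` digits in `L` recover all of `N`.
    · have := eval_ofCoeffList_digitList Q (k + 1) N
      rw [Nat.mod_eq_of_lt hN, ← hL] at this
      rw [eval_mul, this, eval_prod_map_qFactorialNat, eval_prod_map_qFactorialNat,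
        hmul]
  have key' : (ofCoeffList L).map (Nat.castRingHom ℤ) * (b.map qFactorial).prod =
      (a.map qFactorial).prod := by
    rw [← map_prod_map_qFactorialNat, ← map_prod_map_qFactorialNat, ← key, Polynomial.map_mul]
  refine isQRiousUnimodal_of_mul_eq key' (by simp) fun i hi => ?_
  have hdeg := natDegree_add_of_mul_eq key'
  have hk : ((ofCoeffList L).map (Nat.castRingHom ℤ)).natDegree = k := by
    simp only [k, qFactorialRatioDegree]
    omega
  rw [hk] at hi
  simp only [coeff_map, coeff_ofCoeffList, eq_natCast, Nat.cast_le]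
  exact getD_le_of_parityMonotone hmono (by omega)

theorem isQRiousUnimodal_of_mem_boberSporadicPairs :
    ∀ p ∈ boberSporadicPairs, IsQRiousUnimodal p.1 p.2 := by
  -- `Q` must exceed every numerator at `q = 1`; the largest is `5! 9! 30!`, about `10 ^ 40`, well
  -- below `2 ^ 160`.
  have h : ∀ p ∈ boberSporadicPairs, checkRatio (2 ^ 160) p.1 p.2 := by decide +kernel
  exact fun p hp => isQRiousUnimodal_of_checkRatio (h p hp)

end

theorem mainTheorem2 :
    (∀ p ∈ boberSporadicPairs, IsQRiousUnimodal p.1 p.2) ∧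
      ∀ m n : ℕ, 0 < m → 0 < n → Nat.Coprime m n → IsQRiousUnimodal [m + n] [m, n] :=
  ⟨isQRiousUnimodal_of_mem_boberSporadicPairs, fun m n _ _ _ => isQRiousUnimodal_qBinomial m n⟩
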